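/- Let $N\ge 2$, let $\mathbf H_1,\dots,\mathbf H_N$ be complex Hilbert spaces with orthonormal bases $\{|k_n\rangle\}_{k_n}$, and let $\psi\in\mathbf H_1\otimes\cdots\otimes\mathbf H_N$ (Hilbert tensor product; inner products are linear in the second argument). For $1\le n\le N-1$, a Schmidt decomposition of $\psi$ with respect to the cut $(1,\dots,n):(n+1,\dots,N)$ is a norm-convergent series $\psi=\sum_{a=0}^\infty\lambda_a\,|x_a\rangle\otimes|y_a\rangle$ with $x_a\in\mathbf H_1\otimes\cdots\otimes\mathbf H_n$, $y_a\in\mathbf H_{n+1}\otimes\cdots\otimes\mathbf H_N$, $\lambda_a\ge 0$, $\lambda_a\to 0$, in which the families $\{x_a:\lambda_a\neq 0\}$ and $\{y_a:\lambda_a\ne 0\}$ are orthonormal. (A decomposition with finitely many terms is padded by terms of weight zero; terms of weight zero do not count as terms of the decomposition.) For every $n\in\{1,\dots,N-1\}$ choose any Schmidt decomposition $\psi=\sum_{a_n}\lambda^{(n)}_{a_n}|x^{(1,\dots,n)}_{a_n}\rangle\otimes|y^{(n+1,\dots,N)}_{a_n}\rangle$ with respect to the cut $(1,\dots,n):(n+1,\dots,N)$,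 and define $$\Gamma^{(k_1)}_{a_1}=\langle k_1|x^{(1)}_{a_1}\rangle,\qquad \Gamma^{(k_N)}_{a_{N-1}}=\langle k_N|y^{(N)}_{a_{N-1}}\rangle,$$ and, for $2\le n\le N-1$, writing $|y^{(n,\dots,N)}_{a_{n-1}}\rangle=\sum_{k_n}|k_n\rangle\otimes|\chi_{a_{n-1},k_n}\rangle$ and $\tau^{(k_n)}_{a_{n-1},a_n}=\langle y^{(n+1,\dots,N)}_{a_n}|\chi_{a_{n-1},k_n}\rangle$, $$\Gamma^{(k_n)}_{a_{n-1},a_n}=\begin{cases}\tau^{(k_n)}_{a_{n-1},a_n}/\lambda^{(n)}_{a_n}&\text{if }\lambda^{(n)}_{a_n}\neq0,\\ \tau^{(k_n)}_{a_{n-1},a_n}&\text{if }\lambda^{(n)}_{a_n}=0.\end{cases}$$ Then $\psi$, with these $\Gamma$ and $\lambda$, is a canonical matrix product state, that is: (1) $\displaystyle\psi=\sum_{k_1,\dots,k_N}\Big(\sum_{a_1}\cdots\sum_{a_{N-1}}\Gamma^{(k_1)}_{a_1}\lambda^{(1)}_{a_1}\Gamma^{(k_2)}_{a_1,a_2}\lambda^{(2)}_{a_2}\cdots\lambda^{(N-1)}_{a_{N-1}}\Gamma^{(k_N)}_{a_{N-1}}\Big)|k_1,\dots,k_N\rangle$,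 where the iterated series converge in $\mathbb C$ and the outer series converges in norm; (2) for every $n\in\{1,\dots,N-1\}$ and every $a_n$ the contracted blocks $$|\phi^{(1,\dots,n)}_{a_n}\rangle=\sum_{k_1,\dots,k_n}\Big(\sum_{a_1}\cdots\sum_{a_{n-1}}\Gamma^{(k_1)}_{a_1}\lambda^{(1)}_{a_1}\cdots\lambda^{(n-1)}_{a_{n-1}}\Gamma^{(k_n)}_{a_{n-1},a_n}\Big)|k_1,\dots,k_n\rangle,$$ $$|\phi^{(n+1,\dots,N)}_{a_n}\rangle=\sum_{k_{n+1},\dots,k_N}\Big(\sum_{a_{n+1}}\cdots\sum_{a_{N-1}}\Gamma^{(k_{n+1})}_{a_n,a_{n+1}}\lambda^{(n+1)}_{a_{n+1}}\cdots\lambda^{(N-1)}_{a_{N-1}}\Gamma^{(k_N)}_{a_{N-1}}\Big)|k_{n+1},\dots,k_N\rangle$$ converge in the same sense, and $\sum_{a_n}\lambda^{(n)}_{a_n}|\phi^{(1,\dots,n)}_{a_n}\rangle\otimes|\phi^{(n+1,\dots,N)}_{a_n}\rangle$ is a Schmidt decomposition of $\psi$ with respect to the cut $(1,\dots,n):(n+1,\dots,N)$.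 -/

import Mathlib

open scoped TensorProduct ComplexConjugate ComplexOrder
open Filter Topology

set_option linter.unusedSectionVars false

noncomputable section

/-! ## The Hilbert tensor product of a finite family of Hilbert spaces

The algebraic tensor product carries the sesquilinear form that is determined by
`⟪⨂ x i, ⨂ y i⟫ = ∏ ⟪x i, y i⟫` (conjugate-linear in the first argument); the Hilbert tensor product
is the completion for the corresponding norm. -/

section AlgebraicTensor

variable {ι : Type*} [Fintype ι] (H : ι → Type*) [∀ i, NormedAddCommGroup (H i)]
  [∀ i, InnerProductSpace ℂ (H i)]

/-- The algebraic tensor product of the spaces `H i` (a copy that does not carry any of the other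
norms on `⨂[ℂ] i, H i`). -/
def AlgTensor : Type _ := ⨂[ℂ] i, H i

namespace AlgTensor

/-- The linear functional `⨂ x i ↦ ∏ ⟪y i, x i⟫`. -/
def pairing (y : ∀ i, H i) : (⨂[ℂ] i, H i) →ₗ[ℂ] ℂ :=
  PiTensorProduct.lift
    ((MultilinearMap.mkPiAlgebra ℂ ι ℂ).compLinearMap (fun i => innerₛₗ ℂ (y i)))

theorem pairing_tprod (y x : ∀ i, H i) :
    pairing H y (PiTensorProduct.tprod ℂ x) = ∏ i, inner ℂ (y i) (x i) := by
  simp [pairing]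

/-- The conjugate-linear functional `⨂ x i ↦ ∏ ⟪x i, y i⟫`. -/
def conjPairing (y : ∀ i, H i) : (⨂[ℂ] i, H i) →ₗ⋆[ℂ] ℂ where
  toFun s := conj (pairing H y s)
  map_add' := by simp
  map_smul' := by simp

theorem conjPairing_tprod (y x : ∀ i, H i) :
    conjPairing H y (PiTensorProduct.tprod ℂ x) = ∏ i, inner ℂ (x i) (y i) := by
  change conj (pairing H y (PiTensorProduct.tprod ℂ x)) = _
  simp [pairing_tprod, map_prod]

theorem conjPairing_ext {f g : (⨂[ℂ] i, H i) →ₗ⋆[ℂ] ℂ}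
    (h : ∀ x : ∀ i, H i, f (PiTensorProduct.tprod ℂ x) = g (PiTensorProduct.tprod ℂ x)) :
    f = g := by
  ext s
  induction s using PiTensorProduct.induction_on with
  | smul_tprod r x => simp [h]
  | add s t hs ht => simp [hs, ht]

/-- The form `(t, s) ↦ ⟪s, t⟫`, linear in `t` and conjugate-linear in `s`. -/
def formFlip : (⨂[ℂ] i, H i) →ₗ[ℂ] ((⨂[ℂ] i, H i) →ₗ⋆[ℂ] ℂ) :=
  PiTensorProduct.lift
    { toFun := conjPairing H
      map_update_add' := by
        intro _ y i a b
        apply conjPairing_ext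
        intro x
        simp only [LinearMap.add_apply, conjPairing_tprod]
        rw [← Finset.mul_prod_erase _ _ (Finset.mem_univ i),
          ← Finset.mul_prod_erase (a := i) _ (fun j => inner ℂ (x j) (Function.update y i a j))
            (Finset.mem_univ i),
          ← Finset.mul_prod_erase (a := i) _ (fun j => inner ℂ (x j) (Function.update y i b j))
            (Finset.mem_univ i)]
        have e : ∀ c : H i, ∏ j ∈ Finset.univ.erase i, inner ℂ (x j) (Function.update y i c j)
            = ∏ j ∈ Finset.univ.erase i, inner ℂ (x j) (y j) := by
          intro c
          refine Finset.prod_congr rfl fun j hj => ?_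
          rw [Function.update_of_ne (Finset.ne_of_mem_erase hj)]
        simp only [e, Function.update_self, inner_add_right, add_mul]
      map_update_smul' := by
        intro _ y i c a
        apply conjPairing_ext
        intro x
        simp only [LinearMap.smul_apply, conjPairing_tprod]
        rw [← Finset.mul_prod_erase _ _ (Finset.mem_univ i),
          ← Finset.mul_prod_erase (a := i) _ (fun j => inner ℂ (x j) (Function.update y i a j))
            (Finset.mem_univ i)]
        have e : ∀ c : H i, ∏ j ∈ Finset.univ.erase i, inner ℂ (x j) (Function.update y i c j)
            = ∏ j ∈ Finset.univ.erase i, inner ℂ (x j) (y j) := by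
          intro c
          refine Finset.prod_congr rfl fun j hj => ?_
          rw [Function.update_of_ne (Finset.ne_of_mem_erase hj)]
        simp only [e, Function.update_self, inner_smul_right, smul_eq_mul, mul_assoc] }

/-- The sesquilinear form on the algebraic tensor product. -/
def form (s t : ⨂[ℂ] i, H i) : ℂ := formFlip H t s

theorem form_tprod (x y : ∀ i, H i) :
    form H (PiTensorProduct.tprod ℂ x) (PiTensorProduct.tprod ℂ y) = ∏ i, inner ℂ (x i) (y i) := by
  simp only [form, formFlip, PiTensorProduct.lift.tprod]
  exact conjPairing_tprod H y x

theorem form_conj (s t : ⨂[ℂ] i, H i) : conj (form H t s) = form H s t := by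
  unfold form
  induction s using PiTensorProduct.induction_on with
  | add s s' hs hs' => simp [hs, hs']
  | smul_tprod r x =>
    induction t using PiTensorProduct.induction_on with
    | add t t' ht ht' => simp only [map_add, LinearMap.add_apply, ht, ht']
    | smul_tprod r' x' =>
      have h1 := form_tprod H x x'
      have h2 := form_tprod H x' x
      simp only [form] at h1 h2
      simp [h1, h2]
      ring

theorem posSemidef_prod_gram {m : ℕ} (g : Fin m → ∀ i, H i) (S : Finset ι) :
    (Matrix.of fun j l => ∏ i ∈ S, inner ℂ (g j i) (g l i) : Matrix (Fin m) (Fin m) ℂ).PosSemidef := by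
  classical
  induction S using Finset.induction_on with
  | empty =>
    have e : (Matrix.of fun j l => ∏ i ∈ (∅ : Finset ι), inner ℂ (g j i) (g l i) :
        Matrix (Fin m) (Fin m) ℂ) = Matrix.gram ℂ (fun _ : Fin m => (1 : ℂ)) := by
      ext j l
      simp
    rw [e]
    exact Matrix.posSemidef_gram ℂ (fun _ : Fin m => (1 : ℂ))
  | insert i S hi ih =>
    have e : (Matrix.of fun j l => ∏ i ∈ insert i S, inner ℂ (g j i) (g l i) :
        Matrix (Fin m) (Fin m) ℂ) = (Matrix.gram ℂ (fun j => g j i)).hadamard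
          (Matrix.of fun j l => ∏ i ∈ S, inner ℂ (g j i) (g l i)) := by
      ext j l
      simp [Finset.prod_insert hi]
    rw [e]
    exact (Matrix.posSemidef_gram ℂ (fun j => g j i)).hadamard ih

theorem form_nonneg (s : ⨂[ℂ] i, H i) : 0 ≤ (form H s s).re := by
  have hs : s ∈ Submodule.span ℂ (Set.range (PiTensorProduct.tprod ℂ (s := H))) := by
    rw [PiTensorProduct.span_tprod_eq_top]; trivial
  obtain ⟨m, f, g, rfl⟩ := (Submodule.mem_span_set').1 hs
  choose x hx using fun j => (g j).2
  have key := (posSemidef_prod_gram H x Finset.univ).dotProduct_mulVec_nonneg f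
  have e : form H (∑ j, f j • (g j : ⨂[ℂ] i, H i)) (∑ j, f j • (g j : ⨂[ℂ] i, H i))
      = star f ⬝ᵥ
        ((Matrix.of fun j l => ∏ i, inner ℂ (x j i) (x l i) : Matrix (Fin m) (Fin m) ℂ).mulVec f) := by
    have h1 : ∀ j l, formFlip H (PiTensorProduct.tprod ℂ (x l)) (PiTensorProduct.tprod ℂ (x j))
        = ∏ i, inner ℂ (x j i) (x l i) := fun j l => form_tprod H (x j) (x l)
    simp only [form, ← hx, map_sum, LinearMap.sum_apply, map_smulₛₗ, LinearMap.smul_apply, h1,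
      dotProduct, Matrix.mulVec, Matrix.of_apply, Pi.star_apply, smul_eq_mul, Finset.mul_sum]
    refine Finset.sum_congr rfl fun j _ => Finset.sum_congr rfl fun l _ => ?_
    simp only [RingHom.id_apply, RCLike.star_def]
    ring
  rw [e]
  exact (Complex.le_def.1 key).1

/-- The form as positive semidefinite Hermitian inner product. -/
@[reducible] def core : PreInnerProductSpace.Core ℂ (⨂[ℂ] i, H i) where
  inner s t := form H s t
  conj_inner_symm s t := form_conj H s t
  re_inner_nonneg s := form_nonneg H s
  add_left s s' t := (formFlip H t).map_add s s'
  smul_left s t r := by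
    change formFlip H t (r • s) = _
    exact (formFlip H t).map_smulₛₗ r s

instance : SeminormedAddCommGroup (AlgTensor H) :=
  @InnerProductSpace.Core.toSeminormedAddCommGroup ℂ (⨂[ℂ] i, H i) _ _ _ (core H)

instance : InnerProductSpace ℂ (AlgTensor H) :=
  @InnerProductSpace.ofCore ℂ (⨂[ℂ] i, H i) _ _ _ (core H)

variable {H}

/-- The elementary tensor `⨂ x i`. -/
def mk (x : ∀ i, H i) : AlgTensor H := PiTensorProduct.tprod ℂ x

theorem inner_mk (x y : ∀ i, H i) :
    inner ℂ (mk x) (mk y) = ∏ i, inner ℂ (x i) (y i) := form_tprod H x y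

theorem induction {motive : AlgTensor H → Prop} (z : AlgTensor H)
    (smul_mk : ∀ (r : ℂ) (x : ∀ i, H i), motive (r • mk x))
    (add : ∀ x y, motive x → motive y → motive (x + y)) : motive z :=
  PiTensorProduct.induction_on z smul_mk add

end AlgTensor

/-- The Hilbert tensor product `⨂ H i`. -/
abbrev HTensor : Type _ := UniformSpace.Completion (AlgTensor H)

namespace HTensor

variable {H}

/-- The product vector `⨂ x i` in the Hilbert tensor product. -/
def tprod (x : ∀ i, H i) : HTensor H := ((AlgTensor.mk x : AlgTensor H) : HTensor H)

theorem inner_tprod (x y : ∀ i, H i) :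
    inner ℂ (tprod x) (tprod y) = ∏ i, inner ℂ (x i) (y i) := by
  rw [tprod, tprod, UniformSpace.Completion.inner_coe, AlgTensor.inner_mk]

end HTensor

end AlgebraicTensor

/-! ## The tensor product of vectors of complementary blocks -/

section BlockProduct

variable {A B C : Type*} [Fintype A] [Fintype B] [Fintype C] {H : C → Type*}
  [∀ i, NormedAddCommGroup (H i)] [∀ i, InnerProductSpace ℂ (H i)] {f : A → C} {g : B → C}

namespace AlgTensor

/-- The canonical bilinear map `(⨂ u, ⨂ v) ↦ ⨂ (u, v)` when the index set is the disjoint union of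
the images of `f` and `g`. -/
def mul (h : Function.Bijective (Sum.elim f g)) :
    AlgTensor (fun a => H (f a)) →ₗ[ℂ] AlgTensor (fun b => H (g b)) →ₗ[ℂ] AlgTensor H :=
  (TensorProduct.mk ℂ (⨂[ℂ] a, H (f a)) (⨂[ℂ] b, H (g b))).compr₂
    ((PiTensorProduct.tmulEquivDep ℂ (fun i : A ⊕ B => H (Sum.elim f g i))).trans
      (PiTensorProduct.reindex ℂ H (Equiv.ofBijective (Sum.elim f g) h).symm).symm).toLinearMap

theorem mul_mk (h : Function.Bijective (Sum.elim f g)) (z : ∀ c, H c) :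
    mul h (mk fun a => z (f a)) (mk fun b => z (g b)) = mk z := by
  change (PiTensorProduct.reindex ℂ H (Equiv.ofBijective (Sum.elim f g) h).symm).symm
    (PiTensorProduct.tmulEquivDep ℂ (fun i : A ⊕ B => H (Sum.elim f g i))
      ((PiTensorProduct.tprod ℂ fun a => z (f a)) ⊗ₜ (PiTensorProduct.tprod ℂ fun b => z (g b))))
      = PiTensorProduct.tprod ℂ z
  refine (LinearEquiv.symm_apply_eq _).2 (Eq.trans ?_ (PiTensorProduct.reindex_tprod (R := ℂ) (s := H)
    (Equiv.ofBijective (Sum.elim f g) h).symm z).symm)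
  refine (PiTensorProduct.tmulEquivDep_apply ℂ (fun i : A ⊕ B => H (Sum.elim f g i))
    (fun a => z (f a)) (fun b => z (g b))).trans ?_
  congr 1
  ext i
  cases i <;> rfl

theorem exists_glue (h : Function.Bijective (Sum.elim f g)) (x : ∀ a, H (f a)) (y : ∀ b, H (g b)) :
    ∃ z : ∀ c, H c, (fun a => z (f a)) = x ∧ (fun b => z (g b)) = y := by
  let e := (Equiv.ofBijective (Sum.elim f g) h).symm
  let w : ∀ i : A ⊕ B, H (Sum.elim f g i) := fun i =>
    match i with
    | Sum.inl a => x a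
    | Sum.inr b => y b
  obtain ⟨z, hz⟩ : ∃ z : ∀ c, H c, ∀ i, z (Sum.elim f g i) = w i := by
    have : ∀ c, ∃ v : H c, ∀ i (hi : Sum.elim f g i = c), v = hi ▸ w i := by
      intro c
      obtain ⟨i, rfl⟩ := h.2 c
      refine ⟨w i, fun j hj => ?_⟩
      obtain rfl := h.1 hj
      rfl
    choose z hz using this
    exact ⟨z, fun i => hz _ i rfl⟩
  exact ⟨z, funext fun a => hz (Sum.inl a), funext fun b => hz (Sum.inr b)⟩

theorem inner_mul_mul (h : Function.Bijective (Sum.elim f g))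
    (s s' : AlgTensor (fun a => H (f a))) (t t' : AlgTensor (fun b => H (g b))) :
    inner ℂ (mul h s t) (mul h s' t') = inner ℂ s s' * inner ℂ t t' := by
  induction s using AlgTensor.induction with
  | add _ _ h1 h2 => simp only [map_add, LinearMap.add_apply, inner_add_left, h1, h2, add_mul]
  | smul_mk r x =>
  induction s' using AlgTensor.induction with
  | add _ _ h1 h2 => simp only [map_add, LinearMap.add_apply, inner_add_right, h1, h2, add_mul]
  | smul_mk r' x' =>
  induction t using AlgTensor.induction with
  | add _ _ h1 h2 => simp only [map_add, inner_add_left, h1, h2, mul_add]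
  | smul_mk q y =>
  induction t' using AlgTensor.induction with
  | add _ _ h1 h2 => simp only [map_add, inner_add_right, h1, h2, mul_add]
  | smul_mk q' y' =>
    obtain ⟨z, rfl, rfl⟩ := exists_glue h x y
    obtain ⟨z', rfl, rfl⟩ := exists_glue h x' y'
    have key : ∀ (r q : ℂ) (z : ∀ c, H c),
        mul h (r • mk fun a => z (f a)) (q • mk fun b => z (g b)) = (r * q) • mk z := by
      intro r q z
      have h1 := LinearMap.map_smul₂ (mul h) r (mk fun a => z (f a)) (q • mk fun b => z (g b))
      rw [h1, LinearMap.map_smul, mul_mk, smul_smul]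
    rw [key, key]
    simp only [inner_smul_left, inner_smul_right, inner_mk]
    have hp : ∀ F : C → ℂ, ∏ c, F c = (∏ a, F (f a)) * ∏ b, F (g b) := by
      intro F
      rw [← (Equiv.ofBijective (Sum.elim f g) h).prod_comp, Fintype.prod_sum_type]
      simp
    rw [hp, map_mul]
    ring

theorem norm_mul (h : Function.Bijective (Sum.elim f g))
    (s : AlgTensor (fun a => H (f a))) (t : AlgTensor (fun b => H (g b))) :
    ‖mul h s t‖ = ‖s‖ * ‖t‖ := by
  rw [← sq_eq_sq₀ (norm_nonneg _) (by positivity), mul_pow, ← Complex.ofReal_inj]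
  push_cast
  have := inner_mul_mul h s s t t
  simpa only [inner_self_eq_norm_sq_to_K, Complex.coe_algebraMap] using this

end AlgTensor

namespace HTensor

/-- The tensor product `u ⊗ v` of vectors of two complementary blocks, as a vector of the whole
tensor product: the continuous bilinear map with `(⨂ u) ⊗ (⨂ v) = ⨂ (u, v)`. This is the
identification `(⨂_A H) ⊗ (⨂_B H) = ⨂_C H` for a partition of `C` into `A` and `B`. -/
def mul (h : Function.Bijective (Sum.elim f g)) :
    HTensor (fun a => H (f a)) →L[ℂ] HTensor (fun b => H (g b)) →L[ℂ] HTensor H :=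
  let m : AlgTensor (fun a => H (f a)) →L[ℂ] AlgTensor (fun b => H (g b)) →L[ℂ] HTensor H :=
    LinearMap.mkContinuous₂
      ((AlgTensor.mul h).compr₂ (UniformSpace.Completion.toComplL (𝕜 := ℂ)).toLinearMap) 1
      (fun s t => by
        change ‖((AlgTensor.mul h s t : AlgTensor H) : HTensor H)‖ ≤ _
        rw [UniformSpace.Completion.norm_coe, AlgTensor.norm_mul, one_mul])
  ((m.extend UniformSpace.Completion.toComplL).flip.extend UniformSpace.Completion.toComplL).flip

theorem mul_coe (h : Function.Bijective (Sum.elim f g))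
    (s : AlgTensor (fun a => H (f a))) (t : AlgTensor (fun b => H (g b))) :
    mul h (s : HTensor (fun a => H (f a))) (t : HTensor (fun b => H (g b)))
      = ((AlgTensor.mul h s t : AlgTensor H) : HTensor H) := by
  unfold mul
  have d1 : DenseRange (UniformSpace.Completion.toComplL (𝕜 := ℂ)
      (E := AlgTensor (fun a => H (f a)))) := UniformSpace.Completion.denseRange_coe
  have i1 : IsUniformInducing (UniformSpace.Completion.toComplL (𝕜 := ℂ)
      (E := AlgTensor (fun a => H (f a)))) := UniformSpace.Completion.isUniformInducing_coe _
  have d2 : DenseRange (UniformSpace.Completion.toComplL (𝕜 := ℂ)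
      (E := AlgTensor (fun b => H (g b)))) := UniformSpace.Completion.denseRange_coe
  have i2 : IsUniformInducing (UniformSpace.Completion.toComplL (𝕜 := ℂ)
      (E := AlgTensor (fun b => H (g b)))) := UniformSpace.Completion.isUniformInducing_coe _
  dsimp only
  rw [ContinuousLinearMap.flip_apply]
  erw [ContinuousLinearMap.extend_eq _ d2 i2 t]
  rw [ContinuousLinearMap.flip_apply]
  erw [ContinuousLinearMap.extend_eq _ d1 i1 s]
  rfl

theorem mul_tprod (h : Function.Bijective (Sum.elim f g)) (z : ∀ c, H c) :
    mul h (tprod fun a => z (f a)) (tprod fun b => z (g b)) = tprod z := by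
  rw [tprod, tprod, mul_coe, AlgTensor.mul_mk, tprod]

end HTensor

end BlockProduct

/-! ## Cuts of a chain of `N` sites and Schmidt decompositions

Sites are numbered `0, …, N - 1`; the cut `n` separates the first `n` sites from the others, and the
bond `n` is the one that is cut. -/

section Cuts

variable {N : ℕ} (H : Fin N → Type*) [∀ i, NormedAddCommGroup (H i)]
  [∀ i, InnerProductSpace ℂ (H i)]

/-- The Hilbert tensor product of the first `n` spaces. -/
abbrev LeftBlock (n : ℕ) : Type _ := HTensor (fun i : {i : Fin N // i.val < n} => H i.1)

/-- The Hilbert tensor product of all but the first `n` spaces. -/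
abbrev RightBlock (n : ℕ) : Type _ := HTensor (fun i : {i : Fin N // n ≤ i.val} => H i.1)

variable {H}

theorem cut_bijective (n : ℕ) :
    Function.Bijective (Sum.elim (fun i : {i : Fin N // i.val < n} => i.1)
      (fun i : {i : Fin N // n ≤ i.val} => i.1)) := by
  constructor
  · rintro (⟨i, hi⟩ | ⟨i, hi⟩) (⟨j, hj⟩ | ⟨j, hj⟩) h <;> simp at h <;> subst h
    · rfl
    · omega
    · omega
    · rfl
  · intro i
    by_cases hi : i.val < n
    · exact ⟨Sum.inl ⟨i, hi⟩, rfl⟩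
    · exact ⟨Sum.inr ⟨i, by omega⟩, rfl⟩

/-- The tensor product `u ⊗ v` of a vector of the first `n` sites and a vector of the others. -/
def tensorCut (n : ℕ) (u : LeftBlock H n) (v : RightBlock H n) : HTensor H :=
  HTensor.mul (cut_bijective n) u v

/-- `∑ a, lam a • x a ⊗ y a` is a Schmidt decomposition of `ψ` with respect to the cut `n`: the
weights are nonnegative and tend to zero, the left and the right Schmidt vectors are orthonormal
families, and the series converges to `ψ` in norm. The series is indexed by `ℕ`; a decomposition
with finitely many terms is padded by terms of weight zero, which do not count as Schmidt terms, so
orthonormality concerns the terms of nonzero weight. -/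
structure IsSchmidtDecomposition (n : ℕ) (ψ : HTensor H) (lam : ℕ → ℝ)
    (x : ℕ → LeftBlock H n) (y : ℕ → RightBlock H n) : Prop where
  nonneg : ∀ a, 0 ≤ lam a
  tendsto_zero : Tendsto lam atTop (𝓝 0)
  orthonormal_left : Orthonormal ℂ (fun a : {a : ℕ // lam a ≠ 0} => x a.1)
  orthonormal_right : Orthonormal ℂ (fun a : {a : ℕ // lam a ≠ 0} => y a.1)
  hasSum : HasSum (fun a => (lam a : ℂ) • tensorCut n (x a) (y a)) ψ

theorem peel_bijective (i : Fin N) :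
    Function.Bijective (Sum.elim
      (fun j : {j : Fin N // j = i} =>
        (⟨j.1, by rw [j.2]⟩ : {j : Fin N // i.val ≤ j.val}))
      (fun j : {j : Fin N // i.val + 1 ≤ j.val} =>
        (⟨j.1, Nat.le_of_succ_le j.2⟩ : {j : Fin N // i.val ≤ j.val}))) := by
  constructor
  · rintro (⟨j, hj⟩ | ⟨j, hj⟩) (⟨l, hl⟩ | ⟨l, hl⟩) h <;> simp at h <;> subst h
    · rfl
    · subst hj
      omega
    · subst hl
      omega
    · rfl
  · rintro ⟨j, hj⟩
    by_cases h : j = i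
    · exact ⟨Sum.inl ⟨j, h⟩, rfl⟩
    · have : j.val ≠ i.val := fun h' => h (Fin.ext h')
      exact ⟨Sum.inr ⟨j, by omega⟩, rfl⟩

/-- The vector `v` of the site `i`, as a vector of a block `S` whose only site is `i`. -/
def siteVec (S : Fin N → Prop) [Fintype {j : Fin N // S j}] (i : Fin N) (v : H i) :
    HTensor (fun j : {j : Fin N // S j} => H j.1) :=
  HTensor.tprod fun j => Pi.single (M := H) i v j.1

/-- The map `w ↦ v ⊗ w` from the block of the sites after `i` to the block of the sites from `i`
on. -/
def attachSite (i : Fin N) (v : H i) : RightBlock H (i.val + 1) →L[ℂ] RightBlock H i.val :=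
  HTensor.mul (H := fun j : {j : Fin N // i.val ≤ j.val} => H j.1) (peel_bijective i)
    (siteVec (fun j => j = i) i v)

/-- The partial inner product `⟨v| ⊗ 1`: for an orthonormal basis `|k⟩` of the site `i` and
`y = ∑ k, |k⟩ ⊗ χ k`, the vector `χ k` is `slice i |k⟩ y`. -/
def slice (i : Fin N) (v : H i) : RightBlock H i.val →L[ℂ] RightBlock H (i.val + 1) :=
  ContinuousLinearMap.adjoint (attachSite i v)

end Cuts

/-! ## Matrix product states -/

section MPS

/-- The iterated series `∑ a_p, (∑ a_q, (… f a))` over the bonds in the list `[p, q, …]`, the first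
one outermost, converges (at every stage) to `s`; the other values of `a` stay as given. -/
def HasIterSum (f : (ℕ → ℕ) → ℂ) : List ℕ → (ℕ → ℕ) → ℂ → Prop
  | [], a, s => s = f a
  | p :: l, a, s => ∃ g : ℕ → ℂ,
      (∀ v, HasIterSum f l (Function.update a p v) (g v)) ∧ HasSum g s

section Contraction

variable {A : Type*} [Fintype A] {E : A → Type*} [∀ i, NormedAddCommGroup (E i)]
  [∀ i, InnerProductSpace ℂ (E i)] {K : A → Type*}

/-- The product basis vector `|k⟩ = ⨂ |k i⟩` of a block of sites. -/
def ket (b : ∀ i, HilbertBasis (K i) ℂ (E i)) (k : ∀ i, K i) : HTensor E :=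
  HTensor.tprod fun i => b i (k i)

/-- The product of the entries `G i (k i) (a (pos i)) (a (pos i + 1))` over the sites of a block and
of the weights `lam j (a j)` over its internal bonds. The site at position `p` has the bond `p` to
its left and the bond `p + 1` to its right. -/
def mpsTerm (pos : A → ℕ) (G : ∀ i, K i → ℕ → ℕ → ℂ) (lam : ℕ → ℕ → ℝ) (bonds : List ℕ)
    (k : ∀ i, K i) (a : ℕ → ℕ) : ℂ :=
  (∏ i, G i (k i) (a (pos i)) (a (pos i + 1))) * (bonds.map fun j => (lam j (a j) : ℂ)).prod

/-- `φ = ∑ k, (∑ a, G ⬝ lam ⬝ G ⬝ ⋯ ⬝ G) |k⟩`: the vector `φ` is the contraction of the block over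
its internal bonds, with the external bond indices given by `a`. -/
def IsContraction (b : ∀ i, HilbertBasis (K i) ℂ (E i)) (pos : A → ℕ)
    (G : ∀ i, K i → ℕ → ℕ → ℂ) (lam : ℕ → ℕ → ℝ) (bonds : List ℕ) (a : ℕ → ℕ)
    (φ : HTensor E) : Prop :=
  ∃ c : (∀ i, K i) → ℂ, (∀ k, HasIterSum (mpsTerm pos G lam bonds k) bonds a (c k)) ∧
    HasSum (fun k => c k • ket b k) φ

end Contraction

variable {N : ℕ} {H : Fin N → Type*} [∀ i, NormedAddCommGroup (H i)]
  [∀ i, InnerProductSpace ℂ (H i)] {κ : Fin N → Type*}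

/-- `ψ` is the matrix product state with open boundary conditions
`∑ k, (∑ a_1 … a_(N-1), G^(k_1)_(a_1) lam^(1)_(a_1) G^(k_2)_(a_1,a_2) ⋯ G^(k_N)_(a_(N-1))) |k⟩`.
The first site ignores its left index and the last one its right index. -/
def IsGammaLambdaMPS (b : ∀ i, HilbertBasis (κ i) ℂ (H i)) (G : ∀ i, κ i → ℕ → ℕ → ℂ)
    (lam : ℕ → ℕ → ℝ) (ψ : HTensor H) : Prop :=
  IsContraction b (fun i : Fin N => i.val) G lam (List.range' 1 (N - 1)) (fun _ => 0) ψ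

/-- `φ` is the contracted block of the sites left of the cut `n`, with index `a` at the cut. -/
def IsLeftContraction (b : ∀ i, HilbertBasis (κ i) ℂ (H i)) (G : ∀ i, κ i → ℕ → ℕ → ℂ)
    (lam : ℕ → ℕ → ℝ) (n a : ℕ) (φ : LeftBlock H n) : Prop :=
  IsContraction (fun i : {i : Fin N // i.val < n} => b i.1) (fun i => i.1.val) (fun i => G i.1)
    lam (List.range' 1 (n - 1)) (fun _ => a) φ

/-- `φ` is the contracted block of the sites right of the cut `n`, with index `a` at the cut. -/
def IsRightContraction (b : ∀ i, HilbertBasis (κ i) ℂ (H i)) (G : ∀ i, κ i → ℕ → ℕ → ℂ)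
    (lam : ℕ → ℕ → ℝ) (n a : ℕ) (φ : RightBlock H n) : Prop :=
  IsContraction (fun i : {i : Fin N // n ≤ i.val} => b i.1) (fun i => i.1.val) (fun i => G i.1)
    lam (List.range' (n + 1) (N - 1 - n)) (fun _ => a) φ

/-- `ψ` is a canonical matrix product state with tensors `G` and weights `lam`: it is the state given
by `G` and `lam`, and for every cut `n` the contracted left and right blocks and the weights `lam n`
form a Schmidt decomposition of `ψ`. -/
def IsCanonicalMPS (b : ∀ i, HilbertBasis (κ i) ℂ (H i)) (G : ∀ i, κ i → ℕ → ℕ → ℂ)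
    (lam : ℕ → ℕ → ℝ) (ψ : HTensor H) : Prop :=
  IsGammaLambdaMPS b G lam ψ ∧
    ∀ n, 1 ≤ n → n < N → ∃ (φL : ℕ → LeftBlock H n) (φR : ℕ → RightBlock H n),
      (∀ a, IsLeftContraction b G lam n a (φL a)) ∧
      (∀ a, IsRightContraction b G lam n a (φR a)) ∧
      IsSchmidtDecomposition n ψ (lam n) φL φR

/-- The tensors `Γ` built from Schmidt decompositions `∑ a, lam n a • x n a ⊗ y n a` at all cuts `n`
and orthonormal bases `b i = {|k⟩}` of the sites:
* at the first site, `Γ^(k)_c = ⟨k | x^(1)_c⟩`;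
* at the last site, `Γ^(k)_a = ⟨k | y^(N-1)_a⟩`;
* in between, `y^(n)_a = ∑ k, |k⟩ ⊗ χ_(a,k)`, the vector `χ_(a,k)` has the coefficient
  `τ^(k)_(a,c) = ⟨y^(n+1)_c | χ_(a,k)⟩` along `y^(n+1)_c`, and `Γ^(k)_(a,c)` is `τ^(k)_(a,c)` divided
  by `lam^(n+1)_c` if this weight is nonzero, and `τ^(k)_(a,c)` if it is zero. -/
def schmidtGamma (b : ∀ i, HilbertBasis (κ i) ℂ (H i)) (lam : ℕ → ℕ → ℝ)
    (x : ∀ n, ℕ → LeftBlock H n) (y : ∀ n, ℕ → RightBlock H n)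
    (i : Fin N) (k : κ i) (a c : ℕ) : ℂ :=
  if i.val = 0 then inner ℂ (siteVec (fun j => j.val < 1) i (b i k)) (x 1 c)
  else if i.val + 1 = N then inner ℂ (siteVec (fun j => i.val ≤ j.val) i (b i k)) (y i.val a)
  else
    if lam (i.val + 1) c = 0 then inner ℂ (y (i.val + 1) c) (slice i (b i k) (y i.val a))
    else inner ℂ (y (i.val + 1) c) (slice i (b i k) (y i.val a)) / (lam (i.val + 1) c : ℂ)

end MPS
end

/-! The iterated sums are evaluated from the innermost bond outwards, that is, from right to left.
Once the bonds to the right of bond `m` have been summed, a block with left index `u` should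
contribute the coefficient `⟨Y m | y m u⟩`, where `Y m` is the product basis vector of the sites
from `m` on. Going one site further left requires that the slice `⟨k|y m u⟩` be recovered from its
coefficients along the Schmidt vectors of the next cut. These vectors need not span the block. If
`lam m u ≠ 0`, however, the slice lies in their closed span, because both decompositions represent
the same `ψ` (`IsSchmidtDecomposition.slice_mem_schmidtSpan`). If `lam m u = 0` and bond `m` is
summed over, the whole summand vanishes, so no identity is needed (`hasIterSum_chain`).

The right block with index `c` is thus `y n c` when `lam n c ≠ 0`. For the left block the same
recursion is closed on the right by `y n c` instead of a basis vector; it gives the partial inner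
product of `ψ` with `y n c`, divided by `lam n c`, which is `x n c`. At weight zero the contracted
blocks may be other vectors. They still have to exist, but they do not enter the Schmidt series. -/

noncomputable section

/-! ### Product vectors and the product basis of the Hilbert tensor product -/

section HilbertTensor

variable {ι : Type*} [Fintype ι] {H : ι → Type*} [∀ i, NormedAddCommGroup (H i)]
  [∀ i, InnerProductSpace ℂ (H i)]

namespace HTensor

theorem clm_ext {F : Type*} [NormedAddCommGroup F] [NormedSpace ℂ F] {f g : HTensor H →L[ℂ] F}
    (h : ∀ x, f (tprod x) = g (tprod x)) : f = g := by
  ext s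
  refine UniformSpace.Completion.induction_on s
    (isClosed_eq f.continuous g.continuous) fun s => ?_
  induction s using AlgTensor.induction with
  | smul_mk r x =>
    rw [UniformSpace.Completion.coe_smul, map_smul, map_smul]
    exact congrArg (r • ·) (h x)
  | add x y hx hy => rw [UniformSpace.Completion.coe_add, map_add, map_add, hx, hy]

theorem eq_zero_of_inner_tprod {w : HTensor H} (h : ∀ x, inner ℂ w (tprod x) = 0) : w = 0 := by
  have : innerSL ℂ w = 0 := clm_ext fun x => by simpa using h x
  have h2 := congrArg (fun f => f w) this
  simpa using h2

/-- The product vector as a linear function of one of its factors. -/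
def tprodLinear [DecidableEq ι] (x : ∀ i, H i) (i : ι) : H i →ₗ[ℂ] HTensor H :=
  (UniformSpace.Completion.toComplL (𝕜 := ℂ) (E := AlgTensor H)).toLinearMap ∘ₗ
    ((PiTensorProduct.tprod ℂ (s := H)).toLinearMap x i : H i →ₗ[ℂ] AlgTensor H)

theorem tprodLinear_apply [DecidableEq ι] (x : ∀ i, H i) (i : ι) (v : H i) :
    tprodLinear x i v = tprod (Function.update x i v) := rfl

theorem norm_tprod (x : ∀ i, H i) : ‖tprod x‖ = ∏ i, ‖x i‖ := by
  rw [← sq_eq_sq₀ (norm_nonneg _) (by positivity), ← Complex.ofReal_inj]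
  have := inner_tprod x x
  simp only [inner_self_eq_norm_sq_to_K, Complex.coe_algebraMap] at this
  rw [Complex.ofReal_pow, this, ← Finset.prod_pow]
  push_cast
  rfl

/-- The product vector as a continuous linear function of one of its factors. -/
def tprodCLM [DecidableEq ι] (x : ∀ i, H i) (i : ι) : H i →L[ℂ] HTensor H :=
  (tprodLinear x i).mkContinuous (∏ j ∈ Finset.univ.erase i, ‖x j‖) fun v => by
    rw [tprodLinear_apply, norm_tprod, ← Finset.mul_prod_erase _ _ (Finset.mem_univ i),
      Function.update_self, mul_comm]
    refine le_of_eq (congrArg (· * ‖v‖) (Finset.prod_congr rfl fun j hj => ?_))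
    rw [Function.update_of_ne (Finset.ne_of_mem_erase hj)]

theorem tprodCLM_apply [DecidableEq ι] (x : ∀ i, H i) (i : ι) (v : H i) :
    tprodCLM x i v = tprod (Function.update x i v) := rfl

end HTensor

variable {K : ι → Type*} (b : ∀ i, HilbertBasis (K i) ℂ (H i))

theorem orthonormal_ket : Orthonormal ℂ (ket b) := by
  classical
  rw [orthonormal_iff_ite]
  intro k l
  rw [ket, ket, HTensor.inner_tprod]
  have h := fun i => orthonormal_iff_ite.1 (b i).orthonormal (k i) (l i)
  simp only [h]
  by_cases e : k = l
  · simp [e]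
  · obtain ⟨i, hi⟩ := Function.ne_iff.1 e
    rw [if_neg e]
    exact Finset.prod_eq_zero (Finset.mem_univ i) (if_neg hi)

/-- Totality of the product basis. The factors that are basis vectors are replaced by arbitrary
vectors one site at a time; each replacement uses continuity in a single factor and density of the
span of that site's basis. In the induction, `S` is the set of sites already freed. -/
theorem inner_tprod_eq_zero_of_inner_ket {w : HTensor H} (h : ∀ k, inner ℂ w (ket b k) = 0)
    (x : ∀ i, H i) : inner ℂ w (HTensor.tprod x) = 0 := by
  classical
  have key : ∀ S : Finset ι, ∀ x : ∀ i, H i, (∀ i, i ∉ S → ∃ k, x i = b i k) →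
      inner ℂ w (HTensor.tprod x) = 0 := by
    intro S
    induction S using Finset.induction_on with
    | empty =>
      intro x hx
      choose k hk using fun i => hx i (Finset.notMem_empty i)
      rw [funext hk]
      exact h k
    | insert i S hi ih =>
      intro x hx
      have h0 : (innerSL ℂ w).comp (HTensor.tprodCLM x i) = 0 := by
        refine ContinuousLinearMap.ext_on (Submodule.dense_iff_topologicalClosure_eq_top.2
          (b i).dense_span) ?_
        rintro _ ⟨k, rfl⟩
        refine ih (Function.update x i (b i k)) fun j hj => ?_
        by_cases hji : j = i
        · subst hji
          exact ⟨k, by simp⟩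
        · rw [Function.update_of_ne hji]
          exact hx j (by simp [hji, hj])
      have := congrArg (fun f => f (x i)) h0
      simpa [HTensor.tprodCLM_apply] using this
  exact key Finset.univ x fun i hi => absurd (Finset.mem_univ i) hi

theorem hasSum_inner_ket (φ : HTensor H) :
    HasSum (fun k => inner ℂ (ket b k) φ • ket b k) φ := by
  have hb : (Submodule.span ℂ (Set.range (ket b)))ᗮ = ⊥ := by
    rw [Submodule.eq_bot_iff]
    intro w hw
    refine HTensor.eq_zero_of_inner_tprod (inner_tprod_eq_zero_of_inner_ket b fun k => ?_)
    exact Submodule.inner_left_of_mem_orthogonal (Submodule.subset_span (Set.mem_range_self k)) hw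
  have := (HilbertBasis.mkOfOrthogonalEqBot (orthonormal_ket b) hb).hasSum_repr φ
  simpa [HilbertBasis.repr_apply_apply] using this

end HilbertTensor

/-! ### Inner products of tensor products of blocks -/

section Blocks

variable {A B C : Type*} [Fintype A] [Fintype B] [Fintype C] {H : C → Type*}
  [∀ i, NormedAddCommGroup (H i)] [∀ i, InnerProductSpace ℂ (H i)] {f : A → C} {g : B → C}

theorem HTensor.inner_mul_mul (h : Function.Bijective (Sum.elim f g))
    (s s' : HTensor (fun a => H (f a))) (t t' : HTensor (fun b => H (g b))) :
    inner ℂ (mul h s t) (mul h s' t') = inner ℂ s s' * inner ℂ t t' := by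
  refine UniformSpace.Completion.induction_on s (isClosed_eq (by fun_prop) (by fun_prop))
    fun s => ?_
  refine UniformSpace.Completion.induction_on s' (isClosed_eq (by fun_prop) (by fun_prop))
    fun s' => ?_
  refine UniformSpace.Completion.induction_on t (isClosed_eq (by fun_prop) (by fun_prop))
    fun t => ?_
  refine UniformSpace.Completion.induction_on t' (isClosed_eq (by fun_prop) (by fun_prop))
    fun t' => ?_
  simp only [mul_coe, UniformSpace.Completion.inner_coe, AlgTensor.inner_mul_mul]

end Blocks

/-! ### Moving sites across a cut -/

section Chain

variable {N : ℕ} {H : Fin N → Type*} [∀ i, NormedAddCommGroup (H i)]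
  [∀ i, InnerProductSpace ℂ (H i)]

theorem inner_tensorCut (n : ℕ) (u u' : LeftBlock H n) (v v' : RightBlock H n) :
    inner ℂ (tensorCut n u v) (tensorCut n u' v') = inner ℂ u u' * inner ℂ v v' :=
  HTensor.inner_mul_mul _ _ _ _ _

theorem siteVec_eq_tprod (S : Fin N → Prop) [Fintype {j : Fin N // S j}] (i : Fin N)
    (hS : ∀ j, S j → j = i) (z : ∀ i, H i) :
    siteVec S i (z i) = HTensor.tprod (fun j : {j : Fin N // S j} => z j.1) := by
  unfold siteVec
  congr 1
  ext ⟨j, hj⟩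
  obtain rfl := hS j hj
  simp

theorem inner_attachSite (i : Fin N) (v v' : H i) (w w' : RightBlock H (i.val + 1)) :
    inner ℂ (attachSite i v w) (attachSite i v' w') = inner ℂ v v' * inner ℂ w w' := by
  unfold attachSite
  refine (HTensor.inner_mul_mul _ _ _ _ _).trans (congrArg (· * _) ?_)
  rw [siteVec, siteVec, HTensor.inner_tprod, Fintype.prod_unique]
  change inner ℂ (Pi.single (M := H) i v i) (Pi.single (M := H) i v' i) = _
  simp

theorem attachSite_tprod (i : Fin N) (z : ∀ i, H i) :
    attachSite i (z i) (HTensor.tprod fun j : {j : Fin N // i.val + 1 ≤ j.val} => z j.1)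
      = HTensor.tprod fun j : {j : Fin N // i.val ≤ j.val} => z j.1 := by
  rw [attachSite, siteVec_eq_tprod _ _ (fun _ h => h)]
  exact HTensor.mul_tprod (peel_bijective i) fun j : {j : Fin N // i.val ≤ j.val} => z j.1

theorem tensorCut_tprod (n : ℕ) (z : ∀ i, H i) :
    tensorCut n (HTensor.tprod fun j : {j : Fin N // j.val < n} => z j.1)
      (HTensor.tprod fun j : {j : Fin N // n ≤ j.val} => z j.1) = HTensor.tprod z :=
  HTensor.mul_tprod (cut_bijective n) z

/-- Associativity of the tensor product: site `i` may be counted on either side. Both sides are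
continuous and linear in `w`, so it suffices to take `w` a product vector, and then both are the
same product over all sites. -/
theorem tensorCut_attachSite (i : Fin N) (z : ∀ i, H i) (w : RightBlock H (i.val + 1)) :
    tensorCut i.val (HTensor.tprod fun j : {j : Fin N // j.val < i.val} => z j.1)
        (attachSite i (z i) w)
      = tensorCut (i.val + 1)
          (HTensor.tprod fun j : {j : Fin N // j.val < i.val + 1} => z j.1) w := by
  have key : (HTensor.mul (H := H) (cut_bijective i.val)
      (HTensor.tprod fun j : {j : Fin N // j.val < i.val} => z j.1)).comp (attachSite i (z i))
      = HTensor.mul (H := H) (cut_bijective (i.val + 1))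
          (HTensor.tprod fun j : {j : Fin N // j.val < i.val + 1} => z j.1) := by
    refine HTensor.clm_ext fun ζ => ?_
    -- One family over all sites that agrees with `ζ` after site `i` and with `z` up to it.
    let z' : ∀ j, H j := fun j => if h : i.val + 1 ≤ j.val then ζ ⟨j, h⟩ else z j
    have e1 : (fun j : {j : Fin N // i.val + 1 ≤ j.val} => z' j.1) = ζ := by
      ext ⟨j, hj⟩
      exact dif_pos hj
    have e2 : (fun j : {j : Fin N // j.val < i.val} => z' j.1) =
        fun j : {j : Fin N // j.val < i.val} => z j.1 := by
      ext ⟨j, hj⟩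
      exact dif_neg (show ¬ (i.val + 1 ≤ j.val) by omega)
    have e3 : (fun j : {j : Fin N // j.val < i.val + 1} => z' j.1) =
        fun j : {j : Fin N // j.val < i.val + 1} => z j.1 := by
      ext ⟨j, hj⟩
      exact dif_neg (show ¬ (i.val + 1 ≤ j.val) by omega)
    have e4 : z i = z' i := by simp [z']
    rw [ContinuousLinearMap.comp_apply, ← e1, ← e2, ← e3, e4, attachSite_tprod]
    exact (tensorCut_tprod i.val z').trans (tensorCut_tprod (i.val + 1) z').symm
  exact congrArg (fun f => f w) key

/-- The vectors obtained from `Z` by attaching the vectors `e i` of the sites left of the cut `M`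
one after the other. -/
theorem exists_attachSite_chain (e : ∀ i, H i) (M : ℕ) (hM : M ≤ N) (Z : RightBlock H M) :
    ∃ Y : ∀ m, RightBlock H m, Y M = Z ∧
      ∀ i : Fin N, i.val < M → Y i.val = attachSite i (e i) (Y (i.val + 1)) := by
  induction M with
  -- The entries of `Y` beyond the starting cut are irrelevant and are set to zero.
  | zero => exact ⟨Function.update 0 0 Z, by simp, fun i hi => absurd hi (Nat.not_lt_zero _)⟩
  | succ M ih =>
    obtain ⟨Y, h1, h2⟩ := ih (by omega) (attachSite ⟨M, hM⟩ (e ⟨M, hM⟩) Z)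
    refine ⟨Function.update Y (M + 1) Z, by simp, fun i hi => ?_⟩
    rw [Function.update_of_ne (by omega)]
    by_cases hiM : i.val = M
    · obtain rfl : i = ⟨M, hM⟩ := Fin.ext hiM
      simp [h1]
    · rw [Function.update_of_ne (by omega)]
      exact h2 i (by omega)

theorem tensorCut_attachSite_chain (e : ∀ i, H i) (M : ℕ) (hM : M ≤ N)
    (Y : ∀ m, RightBlock H m)
    (hY : ∀ i : Fin N, i.val < M → Y i.val = attachSite i (e i) (Y (i.val + 1)))
    (m : ℕ) (hm : m ≤ M) :
    tensorCut m (HTensor.tprod fun j : {j : Fin N // j.val < m} => e j.1) (Y m)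
      = tensorCut M (HTensor.tprod fun j : {j : Fin N // j.val < M} => e j.1) (Y M) := by
  induction M, hm using Nat.le_induction with
  | base => rfl
  | succ M hm ih =>
    rw [ih (by omega) fun i hi => hY i (by omega), hY ⟨M, hM⟩ (Nat.lt_succ_self M)]
    exact tensorCut_attachSite ⟨M, hM⟩ e _

end Chain

/-! ### Iterated series and the right-to-left contraction -/

section IterSum

theorem HasIterSum.zero_of_eq_zero {f : (ℕ → ℕ) → ℂ} {l : List ℕ} {a : ℕ → ℕ}
    (h : ∀ a', (∀ j, j ∉ l → a' j = a j) → f a' = 0) : HasIterSum f l a 0 := by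
  induction l generalizing a with
  | nil => exact (h a fun _ _ => rfl).symm
  | cons p l ih =>
    refine ⟨fun _ => 0, fun v => ih fun a' ha' => h a' fun j hj => ?_, hasSum_zero⟩
    rw [ha' j (fun hl => hj (List.mem_cons_of_mem _ hl)),
      Function.update_of_ne (fun e => hj (by simp [e]))]

/-- The relation between `f'` and `f` is needed only where the indices outside `l` keep their
values. Hence `q` may depend on the bonds already fixed. -/
theorem HasIterSum.const_mul {f f' : (ℕ → ℕ) → ℂ} {l : List ℕ} {a : ℕ → ℕ} {s : ℂ} (q : ℂ)
    (hs : HasIterSum f l a s)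
    (h : ∀ a', (∀ j, j ∉ l → a' j = a j) → f' a' = q * f a') : HasIterSum f' l a (q * s) := by
  induction l generalizing a s with
  | nil =>
    rw [show s = f a from hs]
    exact (h a fun _ _ => rfl).symm
  | cons p l ih =>
    obtain ⟨g, hg, hsum⟩ := hs
    refine ⟨fun v => q * g v, fun v => ih (hg v) fun a' ha' => h a' fun j hj => ?_,
      hsum.mul_left q⟩
    rw [ha' j (fun hl => hj (List.mem_cons_of_mem _ hl)),
      Function.update_of_ne (fun e => hj (by simp [e]))]

/-- The contraction of a chain of `L + 1` tensors `g n, …, g (n + L)`, computed from right to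
left. -/
theorem hasIterSum_chain (g : ℕ → ℕ → ℕ → ℂ) (w : ℕ → ℕ → ℂ) (C : ℕ → ℕ → ℂ) (L n : ℕ)
    (a : ℕ → ℕ)
    (hlast : ∀ u, (L = 0 → u = a n) → C (n + L) u = g (n + L) u (a (n + L + 1)))
    (hstep : ∀ m u, n ≤ m → m < n + L → (m = n → u = a n) → (n < m → w m u ≠ 0) →
      HasSum (fun v => g m u v * w (m + 1) v * C (m + 1) v) (C m u)) :
    HasIterSum (fun a => (∏ j ∈ Finset.Ico n (n + L + 1), g j (a j) (a (j + 1)))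
      * ((List.range' (n + 1) L).map fun j => w j (a j)).prod) (List.range' (n + 1) L) a
      (C n (a n)) := by
  induction L generalizing n a with
  | zero =>
    change C n (a n) = _
    simpa using hlast (a n) fun _ => rfl
  | succ L ih =>
    refine ⟨fun v => g n (a n) v * w (n + 1) v * C (n + 1) v, fun v => ?_,
      hstep n (a n) le_rfl (by omega) (fun _ => rfl) (fun h => absurd h (lt_irrefl n))⟩
    -- With the indices at bonds `n` and `n + 1` fixed, the tensor of site `n` and the weight of
    -- bond `n + 1` are a constant factor of the inner series.
    have hprod : ∀ a' : ℕ → ℕ,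
        (∀ j, j ∉ List.range' (n + 1 + 1) L → a' j = Function.update a (n + 1) v j) →
        (∏ j ∈ Finset.Ico n (n + (L + 1) + 1), g j (a' j) (a' (j + 1)))
          * ((List.range' (n + 1) (L + 1)).map fun j => w j (a' j)).prod
        = g n (a n) v * w (n + 1) v *
          ((∏ j ∈ Finset.Ico (n + 1) (n + 1 + L + 1), g j (a' j) (a' (j + 1)))
          * ((List.range' (n + 1 + 1) L).map fun j => w j (a' j)).prod) := by
      intro a' ha'
      have h1 : a' n = a n := by
        rw [ha' n (by simp [List.mem_range'_1]), Function.update_of_ne (by omega)]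
      have h2 : a' (n + 1) = v := by
        rw [ha' (n + 1) (by simp [List.mem_range'_1]), Function.update_self]
      rw [Finset.prod_eq_prod_Ico_succ_bot (by omega), List.range'_succ, List.map_cons,
        List.prod_cons, h1, h2, show n + (L + 1) + 1 = n + 1 + L + 1 by omega]
      ring
    -- At weight zero every inner term vanishes, so the inner series converge to zero whatever `C (n
    -- + 1) v` is. This is why `hstep` may assume nonzero weights on internal bonds.
    by_cases hw : w (n + 1) v = 0
    · beta_reduce
      rw [hw, mul_zero, zero_mul]
      refine HasIterSum.zero_of_eq_zero fun a' ha' => ?_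
      rw [hprod a' ha', hw, mul_zero, zero_mul]
    · refine HasIterSum.const_mul _ ?_ hprod
      have := ih (n + 1) (Function.update a (n + 1) v)
        (fun u hu => by
          have := hlast u (by omega)
          rw [Function.update_of_ne (by omega)]
          rwa [show n + 1 + L = n + (L + 1) by omega])
        (fun m u h1 h2 h3 h4 => hstep m u (by omega) (by omega) (by omega) fun _ => by
          by_cases hm : m = n + 1
          · rw [h3 hm, hm, Function.update_self]
            exact hw
          · exact h4 (by omega))
      rwa [Function.update_self] at this

/-- Transfers the contraction of a chain to a block whose sites are indexed by any finite type, with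
`pos` a bijection onto the interval from `n` to `n + L`. `C m u` is the value of the part from site
`m` on with left index `u`. -/
theorem hasIterSum_mpsTerm {A : Type*} [Fintype A] {K : A → Type*} (pos : A → ℕ)
    (G : ∀ i, K i → ℕ → ℕ → ℂ) (lam : ℕ → ℕ → ℝ) (C : ℕ → ℕ → ℂ) (L n : ℕ) (k : ∀ i, K i)
    (a : ℕ → ℕ) (hpos : Function.Injective pos) (hrange : ∀ j, (∃ i, pos i = j) ↔ n ≤ j ∧ j ≤ n + L)
    (hlast : ∀ i u, pos i = n + L → (L = 0 → u = a n) →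
      C (n + L) u = G i (k i) u (a (n + L + 1)))
    (hstep : ∀ i u, pos i < n + L → (pos i = n → u = a n) → (n < pos i → lam (pos i) u ≠ 0) →
      HasSum (fun v => G i (k i) u v * lam (pos i + 1) v * C (pos i + 1) v) (C (pos i) u)) :
    HasIterSum (mpsTerm pos G lam (List.range' (n + 1) L) k) (List.range' (n + 1) L) a
      (C n (a n)) := by
  classical
  let g : ℕ → ℕ → ℕ → ℂ := fun j => if h : ∃ i, pos i = j then G h.choose (k h.choose) else 0
  have hg : ∀ i, g (pos i) = G i (k i) := by
    intro i
    have h : ∃ i', pos i' = pos i := ⟨i, rfl⟩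
    have e : h.choose = i := hpos h.choose_spec
    simp only [g, dif_pos h]
    rw [e]
  have hf : mpsTerm pos G lam (List.range' (n + 1) L) k = fun a =>
      (∏ j ∈ Finset.Ico n (n + L + 1), g j (a j) (a (j + 1)))
      * ((List.range' (n + 1) L).map fun j => ((lam j (a j) : ℝ) : ℂ)).prod := by
    funext a
    rw [mpsTerm]
    congr 1
    refine Finset.prod_nbij pos (fun i _ => ?_) hpos.injOn (fun j hj => ?_) fun i _ => by rw [hg]
    · have := (hrange (pos i)).1 ⟨i, rfl⟩
      exact Finset.mem_Ico.2 ⟨this.1, by omega⟩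
    · have hj := Finset.mem_Ico.1 hj
      obtain ⟨i, hi⟩ := (hrange j).2 ⟨hj.1, by omega⟩
      exact ⟨i, by simp, hi⟩
  rw [hf]
  refine hasIterSum_chain g (fun j v => (lam j v : ℂ)) C L n a (fun u hu => ?_)
    fun m u h1 h2 h3 h4 => ?_
  · obtain ⟨i, hi⟩ := (hrange (n + L)).2 ⟨by omega, le_rfl⟩
    rw [hlast i u hi hu, ← hg, hi]
  · obtain ⟨i, rfl⟩ := (hrange m).2 ⟨h1, by omega⟩
    rw [hg]
    exact hstep i u h2 h3 fun h => by simpa using h4 h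

end IterSum

/-! ### Expansion along an orthonormal family that need not be complete -/

section OrthonormalExpansion

variable {E ι : Type*} [NormedAddCommGroup E] [InnerProductSpace ℂ E] [CompleteSpace E]

theorem Orthonormal.hasSum_inner_smul_starProjection {v : ι → E} (hv : Orthonormal ℂ v) (χ : E) :
    HasSum (fun i => inner ℂ (v i) χ • v i)
      ((Submodule.span ℂ (Set.range v)).topologicalClosure.starProjection χ) := by
  have hs : Summable fun i => inner ℂ (v i) χ • v i :=
    (hv.orthogonalFamily.summable_iff_norm_sq_summable fun i => inner ℂ (v i) χ).2
      (hv.inner_products_summable χ)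
  have hmem : ∑' i, inner ℂ (v i) χ • v i ∈ (Submodule.span ℂ (Set.range v)).topologicalClosure :=
    (Submodule.isClosed_topologicalClosure _).mem_of_tendsto hs.hasSum
      (Filter.Eventually.of_forall fun s => Submodule.sum_mem _ fun i _ => Submodule.smul_mem _ _
        (Submodule.le_topologicalClosure _ (Submodule.subset_span (Set.mem_range_self i))))
  have hinner : ∀ j, inner ℂ (v j) (∑' i, inner ℂ (v i) χ • v i) = inner ℂ (v j) χ := by
    intro j
    have h1 := hs.hasSum.mapL (innerSL ℂ (v j))
    have h2 : HasSum (fun i => innerSL ℂ (v j) (inner ℂ (v i) χ • v i)) (inner ℂ (v j) χ) := by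
      convert hasSum_single j _ using 1
      · simp [hv.1 j]
      · intro i hij
        simp [hv.2 (Ne.symm hij)]
    exact h1.unique h2
  rw [Submodule.eq_starProjection_of_mem_orthogonal hmem
    (u := χ) (v := ∑' i, inner ℂ (v i) χ • v i) ?_]
  · exact hs.hasSum
  · rw [Submodule.orthogonal_closure, Submodule.mem_orthogonal]
    intro u hu
    induction hu using Submodule.span_induction with
    | mem u hu =>
      obtain ⟨j, rfl⟩ := hu
      rw [inner_sub_right, hinner, sub_self]
    | zero => simp
    | add u w _ _ h1 h2 => rw [inner_add_left, h1, h2, add_zero]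
    | smul r u _ h => rw [inner_smul_left, h, mul_zero]

end OrthonormalExpansion

/-! ### Schmidt vectors at neighbouring cuts -/

section Schmidt

variable {N : ℕ} {H : Fin N → Type*} [∀ i, NormedAddCommGroup (H i)]
  [∀ i, InnerProductSpace ℂ (H i)] {n : ℕ} {ψ : HTensor H} {lam : ℕ → ℝ}
  {x : ℕ → LeftBlock H n} {y : ℕ → RightBlock H n}

theorem IsSchmidtDecomposition.hasSum_inner (hS : IsSchmidtDecomposition n ψ lam x y)
    (U : LeftBlock H n) (Z : RightBlock H n) :
    HasSum (fun a => (lam a : ℂ) * (inner ℂ U (x a) * inner ℂ Z (y a)))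
      (inner ℂ (tensorCut n U Z) ψ) := by
  have := hS.hasSum.mapL (innerSL ℂ (tensorCut n U Z))
  simpa [inner_smul_right, inner_tensorCut] using this

theorem IsSchmidtDecomposition.inner_left (hS : IsSchmidtDecomposition n ψ lam x y) {u : ℕ}
    (hu : lam u ≠ 0) (Z : RightBlock H n) :
    inner ℂ (tensorCut n (x u) Z) ψ = lam u * inner ℂ Z (y u) := by
  refine (hS.hasSum_inner (x u) Z).unique ?_
  convert hasSum_single u _ using 1
  · have := hS.orthonormal_left.1 ⟨u, hu⟩
    simp [inner_self_eq_norm_sq_to_K, this]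
  · intro a ha
    by_cases h0 : lam a = 0
    · simp [h0]
    · have : inner ℂ (x u) (x a) = 0 :=
        hS.orthonormal_left.2 (i := ⟨u, hu⟩) (j := ⟨a, h0⟩) fun e => ha (congrArg Subtype.val e).symm
      simp [this]

theorem IsSchmidtDecomposition.inner_right (hS : IsSchmidtDecomposition n ψ lam x y) {u : ℕ}
    (hu : lam u ≠ 0) (U : LeftBlock H n) :
    inner ℂ (tensorCut n U (y u)) ψ = lam u * inner ℂ U (x u) := by
  refine (hS.hasSum_inner U (y u)).unique ?_
  convert hasSum_single u _ using 1
  · have := hS.orthonormal_right.1 ⟨u, hu⟩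
    simp [inner_self_eq_norm_sq_to_K, this]
  · intro a ha
    by_cases h0 : lam a = 0
    · simp [h0]
    · have : inner ℂ (y u) (y a) = 0 :=
        hS.orthonormal_right.2 (i := ⟨u, hu⟩) (j := ⟨a, h0⟩)
          fun e => ha (congrArg Subtype.val e).symm
      simp [this]

theorem inner_slice (i : Fin N) (v : H i) (Z : RightBlock H (i.val + 1)) (w : RightBlock H i.val) :
    inner ℂ Z (slice i v w) = inner ℂ (attachSite i v Z) w :=
  ContinuousLinearMap.adjoint_inner_right _ _ _

/-- For a product vector `U`, regrouping moves `v` to the left factor, and the inner product then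
contains the factor `⟨Z|w⟩ = 0`. The general `U` follows by continuity. -/
theorem inner_tensorCut_attachSite_eq_zero (i : Fin N) (v : H i) (U : LeftBlock H i.val)
    {w Z : RightBlock H (i.val + 1)} (V : LeftBlock H (i.val + 1)) (h : inner ℂ Z w = 0) :
    inner ℂ (tensorCut (i.val + 1) V Z) (tensorCut i.val U (attachSite i v w)) = 0 := by
  have key : (innerSL ℂ (tensorCut (i.val + 1) V Z)).comp
      ((HTensor.mul (H := H) (cut_bijective i.val)).flip (attachSite i v w)) = 0 := by
    refine HTensor.clm_ext fun ξ => ?_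
    let z : ∀ j, H j := fun j => if h : j.val < i.val then ξ ⟨j, h⟩ else Pi.single (M := H) i v j
    have e1 : (fun j : {j : Fin N // j.val < i.val} => z j.1) = ξ := by
      ext ⟨j, hj⟩
      exact dif_pos hj
    have e2 : v = z i := by simp [z]
    rw [← e1, e2]
    change inner ℂ (tensorCut (i.val + 1) V Z) (tensorCut i.val _ (attachSite i (z i) w)) = 0
    rw [tensorCut_attachSite, inner_tensorCut, h, mul_zero]
  exact congrArg (fun f => f U) key

/-- The closed span of the right Schmidt vectors of nonzero weight. -/
def schmidtSpan (lam : ℕ → ℝ) (y : ℕ → RightBlock H n) : Submodule ℂ (RightBlock H n) :=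
  (Submodule.span ℂ (Set.range fun a : {a : ℕ // lam a ≠ 0} => y a.1)).topologicalClosure

instance (lam : ℕ → ℝ) (y : ℕ → RightBlock H n) : CompleteSpace (schmidtSpan lam y) :=
  inferInstanceAs (CompleteSpace
    (Submodule.span ℂ (Set.range fun a : {a : ℕ // lam a ≠ 0} => y a.1)).topologicalClosure)

theorem mem_schmidtSpan {a : ℕ} (ha : lam a ≠ 0) : y a ∈ schmidtSpan lam y :=
  Submodule.le_topologicalClosure _ (Submodule.subset_span ⟨⟨a, ha⟩, rfl⟩)

/-- The compatibility of neighbouring cuts. Let `w` be orthogonal to all `y' a` of nonzero weight.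
By the second decomposition `x u ⊗ v ⊗ w` is orthogonal to `ψ`; by the first its inner product with
`ψ` is `lam u * ⟨w | slice i v (y u)⟩`. Hence the slice is orthogonal to every such `w`. -/
theorem IsSchmidtDecomposition.slice_mem_schmidtSpan {i : Fin N} {lam lam' : ℕ → ℝ}
    {x : ℕ → LeftBlock H i.val} {y : ℕ → RightBlock H i.val}
    {x' : ℕ → LeftBlock H (i.val + 1)} {y' : ℕ → RightBlock H (i.val + 1)}
    (hS : IsSchmidtDecomposition i.val ψ lam x y)
    (hS' : IsSchmidtDecomposition (i.val + 1) ψ lam' x' y') (v : H i) {u : ℕ} (hu : lam u ≠ 0) :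
    slice i v (y u) ∈ schmidtSpan lam' y' := by
  rw [← Submodule.orthogonal_orthogonal (schmidtSpan lam' y'), Submodule.mem_orthogonal]
  intro w hw
  have h0 : inner ℂ ψ (tensorCut i.val (x u) (attachSite i v w)) = 0 := by
    rw [← inner_conj_symm, map_eq_zero]
    have h1 := hS'.hasSum.mapL (innerSL ℂ (tensorCut i.val (x u) (attachSite i v w)))
    refine h1.unique ?_
    convert hasSum_zero with a
    rw [innerSL_apply_apply, inner_smul_right]
    by_cases ha : lam' a = 0
    · simp [ha]
    · rw [← inner_conj_symm, inner_tensorCut_attachSite_eq_zero i v (x u) (x' a)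
        (Submodule.inner_right_of_mem_orthogonal (mem_schmidtSpan ha) hw), map_zero, mul_zero]
  have h1 := hS.inner_left hu (attachSite i v w)
  rw [← inner_conj_symm, h0, map_zero] at h1
  rw [inner_slice]
  simpa [hu] using h1.symm

/-- The operator `1 ⊗ P`, where `P` is the orthogonal projection onto `K`, applied to `w`. -/
theorem exists_inner_attachSite_eq (i : Fin N) (K : Submodule ℂ (RightBlock H (i.val + 1)))
    [CompleteSpace K] (w : RightBlock H i.val) :
    ∃ φ : RightBlock H i.val, ∀ v Z, inner ℂ (attachSite i v Z) φ
      = inner ℂ Z (K.starProjection (slice i v w)) := by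
  -- The range of `1 ⊗ P` is the closed span of the vectors `v ⊗ Z` with `Z ∈ K`, so the operator is
  -- obtained as the orthogonal projection onto that subspace.
  let S : Set (RightBlock H i.val) := {t | ∃ v, ∃ Z ∈ K, t = attachSite i v Z}
  let W := (Submodule.span ℂ S).topologicalClosure
  refine ⟨W.starProjection w, fun v Z => ?_⟩
  have h1 : attachSite i v (K.starProjection Z) ∈ W :=
    Submodule.le_topologicalClosure _
      (Submodule.subset_span ⟨v, _, Submodule.starProjection_apply_mem K Z, rfl⟩)
  have h2 : attachSite i v (Z - K.starProjection Z) ∈ Wᗮ := by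
    rw [Submodule.orthogonal_closure, Submodule.mem_orthogonal]
    intro u hu
    induction hu using Submodule.span_induction with
    | mem u hu =>
      obtain ⟨v', Z', hZ', rfl⟩ := hu
      rw [inner_attachSite, Submodule.inner_right_of_mem_orthogonal hZ'
        (Submodule.sub_starProjection_mem_orthogonal Z), mul_zero]
    | zero => simp
    | add u w _ _ h1 h2 => rw [inner_add_left, h1, h2, add_zero]
    | smul r u _ h => rw [inner_smul_left, h, mul_zero]
  have h3 : attachSite i v Z = attachSite i v (K.starProjection Z)
      + attachSite i v (Z - K.starProjection Z) := by rw [← map_add, add_sub_cancel]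
  rw [h3, inner_add_left, Submodule.inner_left_of_mem_orthogonal
    (Submodule.starProjection_apply_mem W w) h2, add_zero,
    ← Submodule.inner_starProjection_left_eq_right W, Submodule.starProjection_eq_self_iff.2 h1,
    ← Submodule.inner_starProjection_left_eq_right K, inner_slice]

end Schmidt

/-! ### One step of the contraction for the tensors `Γ` -/

section Gamma

variable {N : ℕ} {H : Fin N → Type*} [∀ i, NormedAddCommGroup (H i)]
  [∀ i, InnerProductSpace ℂ (H i)] {κ : Fin N → Type*}
  {b : ∀ i, HilbertBasis (κ i) ℂ (H i)} {ψ : HTensor H} {lam : ℕ → ℕ → ℝ}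
  {x : ∀ n, ℕ → LeftBlock H n} {y : ∀ n, ℕ → RightBlock H n}

theorem schmidtGamma_of_lt {i : Fin N} (h0 : i.val ≠ 0) (h1 : i.val + 1 < N) (k : κ i) (u v : ℕ) :
    schmidtGamma b lam x y i k u v =
      (if lam (i.val + 1) v = 0 then 1 else (lam (i.val + 1) v : ℂ))⁻¹ *
        inner ℂ (y (i.val + 1) v) (slice i (b i k) (y i.val u)) := by
  rw [schmidtGamma, if_neg h0, if_neg h1.ne]
  split_ifs
  · simp
  · rw [div_eq_inv_mul]

/-- The product `Γ * lam` is the coefficient `τ` where the weight is nonzero and zero elsewhere, so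
the sum over the bond yields only the projection of the slice. No condition is imposed on the weight
at `u`. -/
theorem hasSum_schmidtGamma (hS : ∀ n, 1 ≤ n → n < N → IsSchmidtDecomposition n ψ (lam n) (x n) (y n))
    {i : Fin N} (h0 : i.val ≠ 0) (h1 : i.val + 1 < N) (k : κ i) (u : ℕ)
    (Z : RightBlock H (i.val + 1)) :
    HasSum (fun v => schmidtGamma b lam x y i k u v * lam (i.val + 1) v
        * inner ℂ Z (y (i.val + 1) v))
      (inner ℂ Z ((schmidtSpan (lam (i.val + 1)) (y (i.val + 1))).starProjection
        (slice i (b i k) (y i.val u)))) := by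
  have h := ((hS (i.val + 1) (by omega) h1).orthonormal_right.hasSum_inner_smul_starProjection
    (slice i (b i k) (y i.val u))).mapL (innerSL ℂ Z)
  refine (hasSum_subtype_iff_of_support_subset (s := {a | lam (i.val + 1) a ≠ 0})
    fun a ha h => ha ?_).1 ?_
  · simp [h]
  · change HasSum (fun a : {a : ℕ // lam (i.val + 1) a ≠ 0} => schmidtGamma b lam x y i k u a.1
      * lam (i.val + 1) a.1 * inner ℂ Z (y (i.val + 1) a.1)) _
    refine HasSum.congr_fun h fun a => ?_
    obtain ⟨a, ha⟩ := a
    simp only [schmidtGamma_of_lt h0 h1, if_neg ha, innerSL_apply_apply,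
      inner_smul_right]
    field_simp

theorem hasSum_schmidtGamma_of_ne_zero
    (hS : ∀ n, 1 ≤ n → n < N → IsSchmidtDecomposition n ψ (lam n) (x n) (y n))
    {i : Fin N} (h0 : i.val ≠ 0) (h1 : i.val + 1 < N) (k : κ i) {u : ℕ} (hu : lam i.val u ≠ 0)
    (Z : RightBlock H (i.val + 1)) :
    HasSum (fun v => schmidtGamma b lam x y i k u v * lam (i.val + 1) v
        * inner ℂ Z (y (i.val + 1) v))
      (inner ℂ (attachSite i (b i k) Z) (y i.val u)) := by
  have h := hasSum_schmidtGamma (b := b) hS h0 h1 k u Z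
  rwa [Submodule.starProjection_eq_self_iff.2 ((hS i.val (by omega) i.2).slice_mem_schmidtSpan
    (hS (i.val + 1) (by omega) h1) (b i k) hu), inner_slice] at h

theorem hasSum_schmidtGamma_first (hS : IsSchmidtDecomposition 1 ψ (lam 1) (x 1) (y 1))
    {i : Fin N} (h0 : i.val = 0) (k : κ i) (u : ℕ) (Z : RightBlock H 1) :
    HasSum (fun v => schmidtGamma b lam x y i k u v * lam 1 v * inner ℂ Z (y 1 v))
      (inner ℂ (tensorCut 1 (siteVec (fun j => j.val < 1) i (b i k)) Z) ψ) := by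
  convert hS.hasSum_inner (siteVec (fun j => j.val < 1) i (b i k)) Z using 2 with v
  rw [schmidtGamma, if_pos h0]
  ring

end Gamma

/-! ### Contraction of the whole chain and of the blocks at a cut -/

section Contractions

variable {N : ℕ} {H : Fin N → Type*} [∀ i, NormedAddCommGroup (H i)]
  [∀ i, InnerProductSpace ℂ (H i)] {κ : Fin N → Type*}
  {b : ∀ i, HilbertBasis (κ i) ℂ (H i)} {ψ : HTensor H} {lam : ℕ → ℕ → ℝ}
  {x : ∀ n, ℕ → LeftBlock H n} {y : ∀ n, ℕ → RightBlock H n}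

/-- The basis vectors of a block, extended by zero to the other sites. -/
theorem exists_extend_basis (b : ∀ i, HilbertBasis (κ i) ℂ (H i)) (S : Fin N → Prop)
    (k : ∀ i : {i : Fin N // S i}, κ i.1) : ∃ e : ∀ i, H i, ∀ i, e i.1 = b i.1 (k i) := by
  classical
  exact ⟨fun i => if h : S i then b i (k ⟨i, h⟩) else 0, fun i => dif_pos i.2⟩

theorem isGammaLambdaMPS_schmidtGamma (hN : 2 ≤ N)
    (hS : ∀ n, 1 ≤ n → n < N → IsSchmidtDecomposition n ψ (lam n) (x n) (y n)) :
    IsGammaLambdaMPS b (schmidtGamma b lam x y) lam ψ := by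
  refine ⟨fun k => inner ℂ (ket b k) ψ, fun k => ?_, hasSum_inner_ket b ψ⟩
  let e : ∀ i, H i := fun i => b i (k i)
  let Y : ∀ m, RightBlock H m := fun m => HTensor.tprod fun j : {j : Fin N // m ≤ j.val} => e j.1
  -- There is no bond to the left of site 0, so the value there is the full coefficient of `ψ`.
  let C : ℕ → ℕ → ℂ := fun m u => if m = 0 then inner ℂ (ket b k) ψ else inner ℂ (Y m) (y m u)
  refine hasIterSum_mpsTerm (fun i : Fin N => i.val) _ lam C (N - 1) 0 k (fun _ => 0)
    Fin.val_injective (fun j => ⟨?_, fun h => ⟨⟨j, by omega⟩, rfl⟩⟩) ?_ ?_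
  · rintro ⟨i, rfl⟩
    omega
  · intro i u hi _
    have h0 : i.val ≠ 0 := by omega
    rw [← hi, schmidtGamma, if_neg h0, if_pos (by omega),
      siteVec_eq_tprod _ i (fun j hj => Fin.ext (by omega)) e]
    exact if_neg h0
  · rintro ⟨_ | m, hm⟩ u hi - hu
    · have h := hasSum_schmidtGamma_first (b := b) (hS 1 le_rfl (by omega)) (i := ⟨0, hm⟩) rfl
        (k _) u (Y 1)
      rw [siteVec_eq_tprod _ _ (fun j hj => Fin.ext (Nat.lt_one_iff.1 hj)) e, tensorCut_tprod] at h
      exact h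
    · have h := hasSum_schmidtGamma_of_ne_zero (b := b) hS (i := ⟨m + 1, hm⟩) (Nat.succ_ne_zero m)
        (by simp only at hi ⊢; omega) (k _) (hu (Nat.succ_pos m)) (Y (m + 1 + 1))
      rw [show attachSite ⟨m + 1, hm⟩ (b _ (k ⟨m + 1, hm⟩)) (Y (m + 1 + 1)) = Y (m + 1) from
        attachSite_tprod ⟨m + 1, hm⟩ e] at h
      exact h

theorem isLeftContraction_one (hN : 2 ≤ N) (c : ℕ) :
    IsLeftContraction b (schmidtGamma b lam x y) lam 1 c (x 1 c) := by
  refine ⟨_, fun k => ?_, hasSum_inner_ket _ _⟩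
  obtain ⟨e, he⟩ := exists_extend_basis b _ k
  refine hasIterSum_mpsTerm (fun i : {i : Fin N // i.val < 1} => i.1.val)
    (fun i => schmidtGamma b lam x y i.1) lam (fun _ _ => inner ℂ (ket _ k) (x 1 c)) 0 0 k
    (fun _ => c) (fun i j h => Subtype.ext (Fin.ext h))
    (fun j => ⟨?_, fun h => ⟨⟨⟨j, by omega⟩, by simp only; omega⟩, rfl⟩⟩) ?_
    fun i _ hi => absurd hi (Nat.not_lt_zero _)
  · rintro ⟨i, rfl⟩
    exact ⟨Nat.zero_le _, by have := i.2; omega⟩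
  · intro i u hi _
    rw [schmidtGamma, if_pos (by omega), ← he,
      siteVec_eq_tprod _ i.1 (fun j hj => Fin.ext (by omega)) e, ket]
    simp only [← he]

/-- The last tensor of the block is a scalar times a coefficient along `y n c`. The block is
therefore contracted like the full chain, with `y n c` in place of the sites right of the cut. -/
theorem isLeftContraction_of_inner {n : ℕ} (hn : 2 ≤ n) (hnN : n < N)
    (hS : ∀ n, 1 ≤ n → n < N → IsSchmidtDecomposition n ψ (lam n) (x n) (y n)) (c : ℕ)
    {φ : LeftBlock H n}
    (hφ : ∀ U, inner ℂ U φ = (if lam n c = 0 then 1 else (lam n c : ℂ))⁻¹ *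
      inner ℂ (tensorCut n U (y n c)) ψ) :
    IsLeftContraction b (schmidtGamma b lam x y) lam n c φ := by
  refine ⟨_, fun k => ?_, hasSum_inner_ket _ _⟩
  obtain ⟨e, he⟩ := exists_extend_basis b _ k
  obtain ⟨Y, hY0, hY⟩ := exists_attachSite_chain e n hnN.le (y n c)
  -- Stated for all `m = n`, since it is used at `i.1.val + 1`, which is only propositionally equal
  -- to `n` and occurs in the types of the vectors.
  have hYn : ∀ m, m = n → Y m = y m c := by
    rintro _ rfl
    exact hY0
  have hk : ket (fun i : {i : Fin N // i.val < n} => b i.1) k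
      = HTensor.tprod fun j : {j : Fin N // j.val < n} => e j.1 := by
    rw [ket]
    simp only [← he]
  obtain ⟨s, hs⟩ : ∃ s : ℂ, ∀ m, m = n → (if lam m c = 0 then 1 else (lam m c : ℂ))⁻¹ = s :=
    ⟨_, by rintro _ rfl; rfl⟩
  let C : ℕ → ℕ → ℂ := fun m u =>
    if m = 0 then inner ℂ (ket (fun i : {i : Fin N // i.val < n} => b i.1) k) φ
    else s * inner ℂ (Y m) (y m u)
  have hC : ∀ m u, m ≠ 0 → C m u = s * inner ℂ (Y m) (y m u) := fun m u h => if_neg h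
  refine hasIterSum_mpsTerm (fun i : {i : Fin N // i.val < n} => i.1.val)
    (fun i => schmidtGamma b lam x y i.1) lam C (n - 1) 0 k
    (fun _ => c) (fun i j h => Subtype.ext (Fin.ext h))
    (fun j => ⟨?_, fun h => ⟨⟨⟨j, by omega⟩, by simp only; omega⟩, rfl⟩⟩) ?_ ?_
  · rintro ⟨i, rfl⟩
    exact ⟨Nat.zero_le _, by have := i.2; omega⟩
  · intro i u hi _
    have h0 : i.1.val ≠ 0 := by omega
    rw [← hi, schmidtGamma_of_lt h0 (by omega), hs _ (by omega), hC _ _ h0, hY i.1 i.2,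
      hYn _ (by omega), inner_slice, he]
  · rintro ⟨⟨_ | m, hm⟩, hmn⟩ u hi - hu
    -- The chain of attached sites collapses to the product vector left of cut `n` tensored with `y
    -- n c`; by `hφ` its inner product with `ψ`, times `s`, is a coefficient of `φ`.
    · have h := (hasSum_schmidtGamma_first (b := b) (hS 1 le_rfl (by omega)) (i := ⟨0, hm⟩) rfl
        (k ⟨⟨0, hm⟩, hmn⟩) u (Y 1)).mul_left s
      rw [← he ⟨⟨0, hm⟩, hmn⟩, siteVec_eq_tprod _ _ (fun j hj => Fin.ext (Nat.lt_one_iff.1 hj)) e,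
        tensorCut_attachSite_chain e n hnN.le Y hY 1 (by omega), hY0, ← hs n rfl, ← hφ, hs n rfl,
        ← hk] at h
      refine HasSum.congr_fun h fun v => ?_
      rw [hC _ _ (Nat.succ_ne_zero 0)]
      simp only [Nat.zero_add]
      ring
    · have h := (hasSum_schmidtGamma_of_ne_zero (b := b) hS (i := ⟨m + 1, hm⟩) (Nat.succ_ne_zero m)
        (by simp only at hmn ⊢; omega) (k ⟨⟨m + 1, hm⟩, hmn⟩) (hu (Nat.succ_pos m))
        (Y (m + 1 + 1))).mul_left s
      rw [← he ⟨⟨m + 1, hm⟩, hmn⟩, ← hY ⟨m + 1, hm⟩ hmn] at h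
      refine HasSum.congr_fun h fun v => ?_
      rw [hC _ _ (Nat.succ_ne_zero _)]
      ring

theorem exists_isLeftContraction {n : ℕ} (hn : 1 ≤ n) (hnN : n < N)
    (hS : ∀ n, 1 ≤ n → n < N → IsSchmidtDecomposition n ψ (lam n) (x n) (y n)) (c : ℕ) :
    ∃ φ, IsLeftContraction b (schmidtGamma b lam x y) lam n c φ ∧
      (lam n c ≠ 0 → φ = x n c) := by
  rcases hn.eq_or_lt with rfl | hn'
  · exact ⟨_, isLeftContraction_one (by omega) c, fun _ => rfl⟩
  -- The partial inner product of `ψ` with `y n c`, scaled as in the definition of `Γ`. It makes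
  -- sense at weight zero too, where `y n c` is arbitrary.
  · let φ : LeftBlock H n := (if lam n c = 0 then 1 else (lam n c : ℂ))⁻¹ •
      ContinuousLinearMap.adjoint ((HTensor.mul (H := H) (cut_bijective n)).flip (y n c)) ψ
    have hφ : ∀ U, inner ℂ U φ = (if lam n c = 0 then 1 else (lam n c : ℂ))⁻¹ *
        inner ℂ (tensorCut n U (y n c)) ψ := by
      intro U
      rw [inner_smul_right, ContinuousLinearMap.adjoint_inner_right]
      rfl
    refine ⟨φ, isLeftContraction_of_inner hn' hnN hS c hφ, fun hc => ?_⟩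
    refine ext_inner_left ℂ fun U => ?_
    rw [hφ, if_neg hc, (hS n hn hnN).inner_right hc, inv_mul_cancel_left₀]
    exact_mod_cast hc

theorem exists_isRightContraction {n : ℕ} (hn : 1 ≤ n) (hnN : n < N)
    (hS : ∀ n, 1 ≤ n → n < N → IsSchmidtDecomposition n ψ (lam n) (x n) (y n)) (c : ℕ) :
    ∃ φ, IsRightContraction b (schmidtGamma b lam x y) lam n c φ ∧
      (lam n c ≠ 0 → φ = y n c) := by
  obtain ⟨φ, hφ, hlast, hfirst⟩ : ∃ φ : RightBlock H n, (lam n c ≠ 0 → φ = y n c) ∧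
      (n + 1 = N → φ = y n c) ∧ ∀ i : Fin N, i.val = n → i.val + 1 < N → ∀ (k : κ i) (e : ∀ i, H i),
        e i = b i k →
        HasSum (fun v => schmidtGamma b lam x y i k c v * lam (i.val + 1) v * inner ℂ
            (HTensor.tprod fun j : {j : Fin N // i.val + 1 ≤ j.val} => e j.1) (y (i.val + 1) v))
          (inner ℂ (HTensor.tprod fun j : {j : Fin N // n ≤ j.val} => e j.1) φ) := by
    -- A block consisting of the last site alone has no bond to sum over, so it gives `y n c`
    -- whatever the weight.
    by_cases h : lam n c ≠ 0 ∨ n + 1 = N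
    · refine ⟨y n c, fun _ => rfl, fun _ => rfl, ?_⟩
      rintro i rfl hi k e he
      rw [← attachSite_tprod, he]
      exact hasSum_schmidtGamma_of_ne_zero hS (by omega) hi k (h.resolve_right hi.ne) _
    · push Not at h
      -- At weight zero the slices of `y n c` may leave the next Schmidt span, and the contraction
      -- yields `(1 ⊗ P) (y n c)` instead of `y n c`.
      obtain ⟨φ, hφ⟩ := exists_inner_attachSite_eq ⟨n, hnN⟩
        (schmidtSpan (lam (n + 1)) (y (n + 1))) (y n c)
      refine ⟨φ, fun h' => absurd h.1 h', fun h' => absurd h' h.2, ?_⟩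
      rintro i hin hi k e he
      obtain rfl : i = ⟨n, hnN⟩ := Fin.ext hin
      have := hasSum_schmidtGamma (b := b) hS (i := ⟨n, hnN⟩) (by simp only; omega) hi k c
        (HTensor.tprod fun j : {j : Fin N // n + 1 ≤ j.val} => e j.1)
      rw [← hφ, ← he, attachSite_tprod] at this
      exact this
  refine ⟨φ, ⟨_, fun k => ?_, hasSum_inner_ket _ _⟩, hφ⟩
  obtain ⟨e, he⟩ := exists_extend_basis b _ k
  have hk : ket (fun i : {i : Fin N // n ≤ i.val} => b i.1) k
      = HTensor.tprod fun j : {j : Fin N // n ≤ j.val} => e j.1 := by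
    rw [ket]
    simp only [← he]
  let Y : ∀ m, RightBlock H m := fun m => HTensor.tprod fun j : {j : Fin N // m ≤ j.val} => e j.1
  let C : ℕ → ℕ → ℂ := fun m u =>
    if m = n then inner ℂ (ket (fun i : {i : Fin N // n ≤ i.val} => b i.1) k) φ
    else inner ℂ (Y m) (y m u)
  have hC : ∀ m u, m ≠ n → C m u = inner ℂ (Y m) (y m u) := fun m u h => if_neg h
  have hCn : ∀ m u, m = n → C m u = inner ℂ (Y n) φ := fun m u h => (if_pos h).trans (by rw [hk])
  have hmain := hasIterSum_mpsTerm (fun i : {i : Fin N // n ≤ i.val} => i.1.val)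
    (fun i => schmidtGamma b lam x y i.1) lam C (N - 1 - n) n k
    (fun _ => c) (fun i j h => Subtype.ext (Fin.ext h))
    (fun j => ⟨?_, fun h => ⟨⟨⟨j, by omega⟩, h.1⟩, rfl⟩⟩) ?_ ?_
  · rw [hCn _ _ rfl] at hmain
    rw [hk]
    exact hmain
  · rintro ⟨i, rfl⟩
    exact ⟨i.2, by omega⟩
  · intro i u hi hu
    have h0 : i.1.val ≠ 0 := by omega
    have hCi : C i.1.val u = inner ℂ (Y i.1.val) (y i.1.val u) := by
      by_cases hin : i.1.val = n
      · have h2 : ∀ m, m = n → C m u = inner ℂ (Y m) (y m u) := by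
          rintro _ rfl
          rw [hCn _ _ rfl, hlast (by omega), hu (by omega)]
        exact h2 _ hin
      · exact hC _ _ hin
    rw [← hi, hCi, schmidtGamma, if_neg h0, if_pos (by omega), ← he,
      siteVec_eq_tprod _ i.1 (fun j hj => Fin.ext (by omega)) e]
  · rintro ⟨i, hin⟩ u hi hu hlam
    simp only at hi hu hlam ⊢
    have hs : ∀ v, C (i.val + 1) v = inner ℂ (Y (i.val + 1)) (y (i.val + 1) v) :=
      fun v => hC _ _ (by omega)
    simp only [hs]
    rcases hin.eq_or_lt with h | h
    · rw [hu h.symm, hCn _ _ h.symm]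
      exact hfirst i h.symm (by omega) _ e (he ⟨i, hin⟩)
    · have h' := hasSum_schmidtGamma_of_ne_zero (b := b) hS (i := i) (by omega) (by omega)
        (k ⟨i, hin⟩) (hlam h) (Y (i.val + 1))
      rw [← he ⟨i, hin⟩, show attachSite i (e i) (Y (i.val + 1)) = Y i.val from
        attachSite_tprod i e] at h'
      rw [hC _ _ h.ne']
      exact h'

end Contractions

end

/-- The matrix product state that is built from arbitrary Schmidt decompositions of `ψ` at all cuts is
canonical. -/
theorem mainTheorem3 {N : ℕ} (hN : 2 ≤ N) {H : Fin N → Type*} [∀ i, NormedAddCommGroup (H i)]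
    [∀ i, InnerProductSpace ℂ (H i)] {κ : Fin N → Type*}
    (b : ∀ i, HilbertBasis (κ i) ℂ (H i)) (ψ : HTensor H) (lam : ℕ → ℕ → ℝ)
    (x : ∀ n, ℕ → LeftBlock H n) (y : ∀ n, ℕ → RightBlock H n)
    (hS : ∀ n, 1 ≤ n → n < N → IsSchmidtDecomposition n ψ (lam n) (x n) (y n)) :
    IsCanonicalMPS b (schmidtGamma b lam x y) lam ψ := by
  refine ⟨isGammaLambdaMPS_schmidtGamma hN hS, fun n hn hnN => ?_⟩
  choose φL hL hLx using fun c => exists_isLeftContraction (b := b) hn hnN hS c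
  choose φR hR hRy using fun c => exists_isRightContraction (b := b) hn hnN hS c
  have hSn := hS n hn hnN
  refine ⟨φL, φR, hL, hR, hSn.nonneg, hSn.tendsto_zero, ?_, ?_, ?_⟩
  · rw [funext fun a : {a : ℕ // lam n a ≠ 0} => hLx a.1 a.2]
    exact hSn.orthonormal_left
  · rw [funext fun a : {a : ℕ // lam n a ≠ 0} => hRy a.1 a.2]
    exact hSn.orthonormal_right
  -- The new blocks may differ from `x n a` and `y n a` only where the weight vanishes, so the two
  -- series agree term by term.
  · refine hSn.hasSum.congr_fun fun a => ?_
    by_cases ha : lam n a = 0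
    · simp [ha]
    · rw [hLx a ha, hRy a ha]
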